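/- **Setting.** An auction has $n$ bidders, bid space $[0,B]$, a context space $\Gamma\subseteq\mathbb R^{d}$ (so $\dim(\Gamma)=d$), feasible sets $\mathcal X(\gamma)\subseteq[0,1]^n$, an allocation rule $x(\mathbf b,\gamma)\in\mathcal X(\gamma)$ and a payment rule $P(\mathbf b,\gamma)\in\mathbb R_+^n$ (both measurable). Values $v_i\in\mathcal V_i\subseteq\mathbb R_+$ are drawn independently from distributions $F_i$ with finite mean, and the context $\gamma$ is drawn from $G$ independently of the values; write $\mathbf F=\prod_i F_i$. A (measurable) strategy profile $\sigma$, $\sigma_i:\mathcal V_i\to[0,B]$, has interim allocation $x_i(b)=E[x_i(b,\sigma_{-i}(v_{-i}),\gamma)]$, interim payment $p_i(b)=E[P_i(b,\sigma_{-i}(v_{-i}),\gamma)]$ and interim utility $u_i(b;v_i)=v_ix_i(b)-p_i(b)$. It is a Bayes–Nash equilibrium if $u_i(\sigma_i(v_i);v_i)\ge u_i(b;v_i)$ for all $i$, $v_i\in\mathcal V_i$, $b\in[0,B]$. Let $$\mathrm{Welfare}=E_{v,\gamma}\Big[\sum_i v_i\,x_i(\sigma(v),\gamma)\Big],\qquad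 \mathrm{OPT}=E_{v,\gamma}\Big[\max_{x\in\mathcal X(\gamma)}\sum_i v_ix_i\Big],$$ where the maximum is attained by some measurable optimal allocation rule $x^{\mathrm{OPT}}(v,\gamma)$. Let $\tilde{\mathcal X}$ be the set of vectors $E_\gamma[\pi(\gamma)]$ over (measurable) policies $\pi$ with $\pi(\gamma)\in\mathcal X(\gamma)$. **Assumption 1.** For every $i$, $x_i$ and $P_i$ are bounded on $[0,B]^n\times\Gamma$; for each own bid $b$ the functions $x_i(b,\cdot,\cdot)$ and $P_i(b,\cdot,\cdot)$ are monotone on $[0,B]^{n-1}\times\Gamma$ (non-decreasing or non-increasing in each coordinate); and $x_i$, $P_i$ are monotone in the own bid. **Assumption 2.** There are constants $\underline p_i>0$ such that $P_i(\mathbf b,\gamma)\ge\underline p_i\,x_i(\mathbf b,\gamma)$ whenever $\mathbf b\in[0,B]^n$, $\gamma\in\Gamma$ and $x_i(\mathbf b,\gamma)>0$. **Estimators.** Let $(v^t,\gamma_t)$, $t=1,2,\dots$, be i.i.d. with law $\mathbf F\times G$; the observations are the bids $\mathbf b_t=\sigma(v^t)$ and the contexts $\gamma_t$. Put $$\hat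 x_i(b)=\frac1T\sum_{t=1}^Tx_i(b,\mathbf b_{-i,t},\gamma_t),\quad \hat p_i(b)=\frac1T\sum_{t=1}^TP_i(b,\mathbf b_{-i,t},\gamma_t),\quad \hat\tau_i(z)=\inf_{b\in[0,B],\ \hat x_i(b)\ge z}\frac{\hat p_i(b)}{\hat x_i(b)}\in[0,\infty]$$ (with $\inf\emptyset=\infty$), $\hat T_i(x)=\int_0^x\hat\tau_i(z)\,dz$, $\tilde{\mathbf T}=\sup_{\tilde x\in\tilde{\mathcal X}}\sum_i\hat T_i(\tilde x_i)$ and $\widehat{\mathrm{Rev}}=\frac1T\sum_{t=1}^T\sum_iP_i(\mathbf b_t,\gamma_t)$. Let $\hat\mu=\tilde{\mathbf T}/\widehat{\mathrm{Rev}}\in[0,\infty]$ and $\hat\rho=\hat\mu\,(1-e^{-\hat\mu})^{-1}$, with $0/0=0$ and $a/0=\infty$ for $a>0$ in $\hat\mu$, and $\hat\rho=1$ if $\hat\mu=0$, $\hat\rho=\infty$ (so $1/\hat\rho=0$) if $\hat\mu=\infty$. **Theorem.** Let $\sigma$ be a Bayes–Nash equilibrium in which the equilibrium utilities are non-negative,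 $u_i(\sigma_i(v_i);v_i)\ge0$ for all $i$ and $v_i\in\mathcal V_i$. Under Assumptions 1 and 2 there is a constant $c>0$ such that for every positive sequence $\gamma(T)\to0$ with $$\gamma(T)^{\,n+\dim(\Gamma)}\Big(\frac{T}{n^2\log T}\Big)^{1/2}\longrightarrow\infty,$$ for all sufficiently large $T$, $$\Pr\Big(\mathrm{Welfare}\ \ge\ \frac1{\hat\rho}\,\mathrm{OPT}-\gamma(T)\Big)\ \ge\ 1-\exp\!\big(-c\,T\,\gamma(T)^4\big),$$ where, should the event fail to be measurable, this is understood as: its complement has outer probability at most $\exp(-c\,T\,\gamma(T)^4)$. -/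

import Mathlib

open MeasureTheory ProbabilityTheory Filter Topology
open scoped ENNReal BigOperators

noncomputable section

namespace EmpiricalPoA

/-- Bid profiles: every bidder bids in `[0, B]`. -/
def bidProfiles (n : ℕ) (B : ℝ) : Set (Fin n → ℝ) := {b | ∀ i, b i ∈ Set.Icc (0 : ℝ) B}

/-- A single-dimensional auction with `n` bidders, bid space `[0, B]` and context space `Γ ⊆ ℝ ^ d`:
feasible allocation sets `X γ`, an allocation rule and a payment rule. The rules are total functions,
but they are constrained (and matter) only on `[0, B] ^ n × Γ`. -/
structure Auction (n d : ℕ) where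
  /-- the largest bid -/
  B : ℝ
  B_nonneg : 0 ≤ B
  /-- the context space -/
  Γ : Set (Fin d → ℝ)
  measurableSet_Γ : MeasurableSet Γ
  /-- the feasible allocations in a context -/
  X : (Fin d → ℝ) → Set (Fin n → ℝ)
  X_subset : ∀ γ ∈ Γ, ∀ x ∈ X γ, ∀ i, x i ∈ Set.Icc (0 : ℝ) 1
  /-- the allocation rule: `alloc b γ i` is the allocation of bidder `i` -/
  alloc : (Fin n → ℝ) → (Fin d → ℝ) → Fin n → ℝ
  /-- the payment rule: `pay b γ i` is the payment of bidder `i` -/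
  pay : (Fin n → ℝ) → (Fin d → ℝ) → Fin n → ℝ
  alloc_mem : ∀ b ∈ bidProfiles n B, ∀ γ ∈ Γ, alloc b γ ∈ X γ
  pay_nonneg : ∀ b ∈ bidProfiles n B, ∀ γ ∈ Γ, ∀ i, 0 ≤ pay b γ i
  measurable_alloc : Measurable (Function.uncurry alloc)
  measurable_pay : Measurable (Function.uncurry pay)

variable {n d : ℕ}

/-- `f` is monotone on `S × Γ`: in each coordinate it is non-decreasing (sign `1`) or non-increasing
(sign `-1`). -/
def SignedMonotoneOn (S : Set (Fin n → ℝ)) (Γ : Set (Fin d → ℝ))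
    (f : (Fin n → ℝ) → (Fin d → ℝ) → ℝ) : Prop :=
  ∃ (s : Fin n → ℝ) (t : Fin d → ℝ), (∀ j, s j = 1 ∨ s j = -1) ∧ (∀ k, t k = 1 ∨ t k = -1) ∧
    ∀ b ∈ S, ∀ b' ∈ S, ∀ γ ∈ Γ, ∀ γ' ∈ Γ,
      (∀ j, s j * b j ≤ s j * b' j) → (∀ k, t k * γ k ≤ t k * γ' k) → f b γ ≤ f b' γ'

/-- Bidder `i`'s outcome `f · · i` is monotone in the competing bids and the context, for each
own bid. (The function below does not depend on the `i`-th coordinate of `b`.) -/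
def MonotoneInRest (A : Auction n d) (f : (Fin n → ℝ) → (Fin d → ℝ) → Fin n → ℝ) (i : Fin n) :
    Prop :=
  ∀ y ∈ Set.Icc (0 : ℝ) A.B,
    SignedMonotoneOn (bidProfiles n A.B) A.Γ (fun b γ => f (Function.update b i y) γ i)

/-- Bidder `i`'s outcome `f · · i` is monotone in the own bid. -/
def MonotoneInOwnBid (A : Auction n d) (f : (Fin n → ℝ) → (Fin d → ℝ) → Fin n → ℝ) (i : Fin n) :
    Prop :=
  (∀ b ∈ bidProfiles n A.B, ∀ γ ∈ A.Γ,
      MonotoneOn (fun y => f (Function.update b i y) γ i) (Set.Icc 0 A.B)) ∨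
  (∀ b ∈ bidProfiles n A.B, ∀ γ ∈ A.Γ,
      AntitoneOn (fun y => f (Function.update b i y) γ i) (Set.Icc 0 A.B))

/-- First assumption: allocation and payment rules are bounded, and monotone in the bids and the
context. -/
structure BoundedMonotoneRules (A : Auction n d) : Prop where
  bounded : ∃ xbar pbar : Fin n → ℝ, ∀ i, ∀ b ∈ bidProfiles n A.B, ∀ γ ∈ A.Γ,
    |A.alloc b γ i| ≤ xbar i ∧ |A.pay b γ i| ≤ pbar i
  alloc_rest : ∀ i, MonotoneInRest A A.alloc i
  pay_rest : ∀ i, MonotoneInRest A A.pay i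
  alloc_own : ∀ i, MonotoneInOwnBid A A.alloc i
  pay_own : ∀ i, MonotoneInOwnBid A A.pay i

/-- Second assumption: a non-zero allocation costs at least an amount proportional to it. -/
def PricePerUnitBound (A : Auction n d) : Prop :=
  ∃ plow : Fin n → ℝ, (∀ i, 0 < plow i) ∧ ∀ i, ∀ b ∈ bidProfiles n A.B, ∀ γ ∈ A.Γ,
    0 < A.alloc b γ i → plow i * A.alloc b γ i ≤ A.pay b γ i

/-- The bid profile played under the strategies `σ` at the value profile `v`. -/
def bids (σ : Fin n → ℝ → ℝ) (v : Fin n → ℝ) : Fin n → ℝ := fun i => σ i (v i)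

/-- Joint law of values (independent across bidders) and context (independent of the values). -/
def joint (F : Fin n → Measure ℝ) (G : Measure (Fin d → ℝ)) :
    Measure ((Fin n → ℝ) × (Fin d → ℝ)) := (Measure.pi F).prod G

/-- Interim allocation of bidder `i` at bid `y`, the others playing `σ`. -/
def interimAlloc (A : Auction n d) (F : Fin n → Measure ℝ) (G : Measure (Fin d → ℝ))
    (σ : Fin n → ℝ → ℝ) (i : Fin n) (y : ℝ) : ℝ :=
  ∫ q, A.alloc (Function.update (bids σ q.1) i y) q.2 i ∂(joint F G)

/-- Interim payment of bidder `i` at bid `y`, the others playing `σ`. -/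
def interimPay (A : Auction n d) (F : Fin n → Measure ℝ) (G : Measure (Fin d → ℝ))
    (σ : Fin n → ℝ → ℝ) (i : Fin n) (y : ℝ) : ℝ :=
  ∫ q, A.pay (Function.update (bids σ q.1) i y) q.2 i ∂(joint F G)

/-- Interim utility of bidder `i` with value `w` at bid `y`, the others playing `σ`. -/
def interimUtil (A : Auction n d) (F : Fin n → Measure ℝ) (G : Measure (Fin d → ℝ))
    (σ : Fin n → ℝ → ℝ) (i : Fin n) (y w : ℝ) : ℝ :=
  w * interimAlloc A F G σ i y - interimPay A F G σ i y

/-- `σ` is a Bayes-Nash equilibrium (in measurable strategies `V i → [0, B]`). -/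
structure IsBNE (A : Auction n d) (V : Fin n → Set ℝ) (F : Fin n → Measure ℝ)
    (G : Measure (Fin d → ℝ)) (σ : Fin n → ℝ → ℝ) : Prop where
  measurable : ∀ i, Measurable (σ i)
  mapsTo : ∀ i, Set.MapsTo (σ i) (V i) (Set.Icc 0 A.B)
  best_response : ∀ i, ∀ w ∈ V i, ∀ y ∈ Set.Icc (0 : ℝ) A.B,
    interimUtil A F G σ i y w ≤ interimUtil A F G σ i (σ i w) w

/-- Interim individual rationality: equilibrium utilities are non-negative. -/
def IndividuallyRational (A : Auction n d) (V : Fin n → Set ℝ) (F : Fin n → Measure ℝ)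
    (G : Measure (Fin d → ℝ)) (σ : Fin n → ℝ → ℝ) : Prop :=
  ∀ i, ∀ w ∈ V i, 0 ≤ interimUtil A F G σ i (σ i w) w

/-- Expected welfare of the strategy profile `σ`. -/
def welfare (A : Auction n d) (F : Fin n → Measure ℝ) (G : Measure (Fin d → ℝ))
    (σ : Fin n → ℝ → ℝ) : ℝ :=
  ∫ q, ∑ i, q.1 i * A.alloc (bids σ q.1) q.2 i ∂(joint F G)

/-- Expected optimal welfare. -/
def optWelfare (A : Auction n d) (F : Fin n → Measure ℝ) (G : Measure (Fin d → ℝ)) : ℝ :=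
  ∫ q, sSup ((fun x : Fin n → ℝ => ∑ i, q.1 i * x i) '' A.X q.2) ∂(joint F G)

/-- The maximum in the optimal welfare is attained by a (measurable) optimal allocation rule. -/
def HasOptimalRule (A : Auction n d) (V : Fin n → Set ℝ) : Prop :=
  ∃ xopt : (Fin n → ℝ) → (Fin d → ℝ) → Fin n → ℝ, Measurable (Function.uncurry xopt) ∧
    ∀ v : Fin n → ℝ, (∀ i, v i ∈ V i) → ∀ γ ∈ A.Γ, xopt v γ ∈ A.X γ ∧
      ∀ x ∈ A.X γ, ∑ i, v i * x i ≤ ∑ i, v i * xopt v γ i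

/-- The marginally feasible allocations: expectations over contexts of feasible policies. -/
def marginallyFeasible (A : Auction n d) (G : Measure (Fin d → ℝ)) : Set (Fin n → ℝ) :=
  {x | ∃ π : (Fin d → ℝ) → Fin n → ℝ, Measurable π ∧ (∀ γ ∈ A.Γ, π γ ∈ A.X γ) ∧
    ∀ i, x i = ∫ γ, π γ i ∂G}

/-- Empirical interim allocation of bidder `i` at bid `y`, from the first `T` observed bid profiles
and contexts. -/
def empAlloc (A : Auction n d) (b : ℕ → Fin n → ℝ) (g : ℕ → Fin d → ℝ) (T : ℕ) (i : Fin n)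
    (y : ℝ) : ℝ :=
  (1 / (T : ℝ)) * ∑ t ∈ Finset.range T, A.alloc (Function.update (b t) i y) (g t) i

/-- Empirical interim payment of bidder `i` at bid `y`. -/
def empPay (A : Auction n d) (b : ℕ → Fin n → ℝ) (g : ℕ → Fin d → ℝ) (T : ℕ) (i : Fin n)
    (y : ℝ) : ℝ :=
  (1 / (T : ℝ)) * ∑ t ∈ Finset.range T, A.pay (Function.update (b t) i y) (g t) i

/-- Empirical threshold price: the smallest empirical price per unit of a bid that empirically
achieves allocation at least `z`; it is `∞` when there is no such bid. -/
def empTau (A : Auction n d) (b : ℕ → Fin n → ℝ) (g : ℕ → Fin d → ℝ) (T : ℕ) (i : Fin n)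
    (z : ℝ) : ℝ≥0∞ :=
  ⨅ (y : ℝ) (_ : y ∈ Set.Icc (0 : ℝ) A.B) (_ : z ≤ empAlloc A b g T i y),
    ENNReal.ofReal (empPay A b g T i y) / ENNReal.ofReal (empAlloc A b g T i y)

/-- Empirical threshold for the allocation `x`. -/
def empThreshold (A : Auction n d) (b : ℕ → Fin n → ℝ) (g : ℕ → Fin d → ℝ) (T : ℕ) (i : Fin n)
    (x : ℝ) : ℝ≥0∞ :=
  ∫⁻ z in Set.Ioc 0 x, empTau A b g T i z

/-- Optimized sum of the empirical thresholds over the marginally feasible allocations. -/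
def empMaxThreshold (A : Auction n d) (G : Measure (Fin d → ℝ)) (b : ℕ → Fin n → ℝ)
    (g : ℕ → Fin d → ℝ) (T : ℕ) : ℝ≥0∞ :=
  ⨆ x ∈ marginallyFeasible A G, ∑ i, empThreshold A b g T i (x i)

/-- Empirical revenue. -/
def empRev (A : Auction n d) (b : ℕ → Fin n → ℝ) (g : ℕ → Fin d → ℝ) (T : ℕ) : ℝ :=
  (1 / (T : ℝ)) * ∑ t ∈ Finset.range T, ∑ i, A.pay (b t) (g t) i

/-- Estimated revenue-covering parameter. -/
def muHat (A : Auction n d) (G : Measure (Fin d → ℝ)) (b : ℕ → Fin n → ℝ)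
    (g : ℕ → Fin d → ℝ) (T : ℕ) : ℝ≥0∞ :=
  empMaxThreshold A G b g T / ENNReal.ofReal (empRev A b g T)

/-- `μ ↦ μ / (1 - exp (-μ))` on `[0, ∞]`, with its limits `1` at `0` and `∞` at `∞`. -/
def rho (μ : ℝ≥0∞) : ℝ≥0∞ :=
  if μ = 0 then 1 else if μ = ∞ then ∞
  else ENNReal.ofReal (μ.toReal * (1 - Real.exp (-μ.toReal))⁻¹)

end EmpiricalPoA

end

/-! The core is a deterministic inequality for a fixed sample. Suppose that, for every bid, the
empirical allocation exceeds the interim one by at most `δ`, the empirical payment falls short by at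
most `δ`, and the empirical revenue exceeds the true one by at most `δ`. By the equilibrium
condition, a bidder with value `w` and equilibrium utility `u` gets empirical utility at most `U = u
+ δ(1 + w)` from any bid. So a bid with empirical allocation at least `z` has unit price at least `w
- U/z`. Integrating over `z` from `exp(-m) x` to `x` bounds the empirical threshold of `x` below by
`(1 - exp(-m)) w x - m U` (`ofReal_le_empThreshold`).

For each value profile, take `x` to be the optimal allocation averaged over contexts, which is
marginally feasible. Summing over bidders, taking `m` to be the estimated covering parameter and
integrating over fresh values gives `(1 - exp(-m)) OPT ≤ m (utilities + revenue + δ L)`, where `L`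
depends only on the mean values. Utilities plus revenue equal welfare, so dividing by `m` yields the
guarantee with loss `δ L` (`IsEnvironment.inv_rho_muHat_mul_le`).

It remains to bound the deviations uniformly in the bid. Monotonicity in the own bid makes this cost
only a factor of order `1/ε` over the Hoeffding bound (`measure_exists_average_lt`). The rate
condition absorbs that factor. -/

namespace EmpiricalPoA

/-! ### Uniform one-sided concentration for monotone families. -/

section Concentration

variable {Ω E : Type*} [MeasurableSpace Ω] [MeasurableSpace E]

/-- One-sided Hoeffding bound for the empirical mean of a bounded function of an i.i.d. sample. -/
theorem measure_average_le_sub (P : Measure Ω) [IsProbabilityMeasure P] (ν : Measure E)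
    (Z : ℕ → Ω → E) (hindep : iIndepFun Z P) (hlaw : ∀ t, HasLaw (Z t) ν P)
    {f : E → ℝ} (hf : Measurable f) {M : ℝ} (hM : 0 < M) (hfM : ∀ᵐ q ∂ν, |f q| ≤ M)
    {ε : ℝ} (hε : 0 ≤ ε) {T : ℕ} (hT : 0 < T) :
    P {ω | (1 / (T : ℝ)) * ∑ t ∈ Finset.range T, f (Z t ω) ≤ ∫ q, f q ∂ν - ε}
      ≤ ENNReal.ofReal (Real.exp (-(T * ε ^ 2 / (2 * M ^ 2)))) := by
  have hT' : (0 : ℝ) < T := by exact_mod_cast hT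
  set c := ∫ q, f q ∂ν with hc
  have hsub : ∀ t, HasSubgaussianMGF (fun ω => c - f (Z t ω)) ((‖M - -M‖₊ / 2) ^ 2) P := by
    intro t
    have hm : AEMeasurable (fun ω => f (Z t ω)) P := hf.comp_aemeasurable (hlaw t).aemeasurable
    have hb : ∀ᵐ ω ∂P, f (Z t ω) ∈ Set.Icc (-M) M := by
      have := hfM
      rw [← (hlaw t).map_eq] at this
      filter_upwards [ae_of_ae_map (hlaw t).aemeasurable this] with ω hω
      exact abs_le.1 hω
    have h := (hasSubgaussianMGF_of_mem_Icc hm hb).neg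
    have hmean : ∫ ω, f (Z t ω) ∂P = c :=
      (hlaw t).integral_comp hf.aestronglyMeasurable
    rw [hmean] at h
    convert h using 1
    ext ω
    simp
  have hind : iIndepFun (fun t ω => c - f (Z t ω)) P :=
    hindep.comp (fun _ q => c - f q) (fun _ => measurable_const.sub hf)
  have key := HasSubgaussianMGF.measure_sum_range_ge_le_of_iIndepFun hind (n := T)
    (fun t _ => hsub t) (ε := T * ε) (by positivity)
  rw [ENNReal.le_ofReal_iff_toReal_le (measure_ne_top _ _) (Real.exp_pos _).le]
  change P.real _ ≤ _
  convert key using 2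
  · ext ω
    simp only [Set.mem_ofPred_eq, Finset.sum_sub_distrib, Finset.sum_const, Finset.card_range,
      nsmul_eq_mul]
    constructor
    · intro h
      have := mul_le_mul_of_nonneg_left h hT'.le
      rw [← mul_assoc, mul_one_div_cancel hT'.ne', one_mul] at this
      linarith
    · intro h
      rw [one_div, inv_mul_le_iff₀ hT']
      linarith
  · have : ‖M - -M‖ = 2 * M := by
      rw [Real.norm_of_nonneg (by linarith)]; ring
    push_cast
    rw [this]
    field_simp

/-- Continuity of measure for a family of events indexed by an arbitrary set of reals. -/
theorem measure_biUnion_le_of_antitoneOn (P : Measure Ω) {S : Set ℝ} {E : ℝ → Set Ω}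
    (hE : AntitoneOn E S) {p : ℝ≥0∞} (hp : ∀ y ∈ S, P (E y) ≤ p) :
    P (⋃ y ∈ S, E y) ≤ p := by
  -- A countable coinitial subset of `S` gives the same union. A countable dense subset is coinitial
  -- except possibly at a least element of `S`, which is added by hand.
  obtain ⟨D, hDS, hDc, hD⟩ : ∃ D ⊆ S, D.Countable ∧ ∀ y ∈ S, ∃ z ∈ D, z ≤ y := by
    obtain ⟨D, hDc, hD⟩ := TopologicalSpace.exists_countable_dense S
    refine ⟨(↑) '' D ∪ {z ∈ S | ∀ y ∈ S, z ≤ y}, ?_, (hDc.image _).union ?_, fun y hy => ?_⟩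
    · rintro _ (⟨z, -, rfl⟩ | ⟨hz, -⟩)
      exacts [z.2, hz]
    · refine Set.Subsingleton.countable ?_
      rintro a ⟨ha, ha'⟩ b ⟨hb, hb'⟩
      exact le_antisymm (ha' b hb) (hb' a ha)
    · by_cases hmin : ∀ z ∈ S, y ≤ z
      · exact ⟨y, Or.inr ⟨hy, hmin⟩, le_rfl⟩
      · push Not at hmin
        obtain ⟨z, hz, hzy⟩ := hmin
        obtain ⟨w, hw, hwD⟩ := hD.inter_open_nonempty (((↑) : S → ℝ) ⁻¹' Set.Iio y)
          (isOpen_Iio.preimage continuous_subtype_val) ⟨⟨z, hz⟩, hzy⟩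
        exact ⟨w, Or.inl ⟨w, hwD, rfl⟩, le_of_lt hw⟩
  have : (⋃ y ∈ S, E y) = ⋃ z : D, E z := by
    ext ω
    simp only [Set.mem_iUnion, exists_prop, Subtype.exists]
    constructor
    · rintro ⟨y, hy, hω⟩
      obtain ⟨z, hz, hzy⟩ := hD y hy
      exact ⟨z, hz, hE (hDS hz) hy hzy hω⟩
    · rintro ⟨z, hz, hω⟩
      exact ⟨z, hDS hz, hω⟩
  have := hDc.to_subtype
  rw [‹(⋃ y ∈ S, E y) = _›, Directed.measure_iUnion]
  · exact iSup_le fun z => hp z (hDS z.2)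
  · intro a b
    rcases le_total (a : ℝ) b with h | h
    · exact ⟨a, le_rfl, hE (hDS a.2) (hDS b.2) h⟩
    · exact ⟨b, hE (hDS b.2) (hDS a.2) h, le_rfl⟩

/-- The parameters are sliced by the value of the mean, in steps of `ε`. Within a slice the bad
events, taken with a common cutoff, are nested because the averages are monotone. Their union
therefore costs no more than one of them, and the union bound runs only over the slices. -/
theorem measure_exists_average_lt_of_monotoneOn (P : Measure Ω) [IsProbabilityMeasure P]
    (ν : Measure E) [IsProbabilityMeasure ν] (Z : ℕ → Ω → E) (hindep : iIndepFun Z P)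
    (hlaw : ∀ t, HasLaw (Z t) ν P)
    {S : Set ℝ} {f : ℝ → E → ℝ} (hf : ∀ y, Measurable (f y)) {M : ℝ} (hM : 0 < M)
    (hfM : ∀ y ∈ S, ∀ᵐ q ∂ν, |f y q| ≤ M)
    (hmono : ∀ᵐ q ∂ν, MonotoneOn (fun y => f y q) S)
    {ε : ℝ} (hε : 0 < ε) {T : ℕ} (hT : 0 < T) {N : ℕ} (hN : 2 * M / ε < N) :
    P {ω | ∃ y ∈ S, (1 / (T : ℝ)) * ∑ t ∈ Finset.range T, f y (Z t ω) < ∫ q, f y q ∂ν - 2 * ε}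
      ≤ N * ENNReal.ofReal (Real.exp (-(T * ε ^ 2 / (2 * M ^ 2)))) := by
  set h : ℝ → ℝ := fun y => ∫ q, f y q ∂ν with hh
  set avg : ℝ → Ω → ℝ := fun y ω => (1 / (T : ℝ)) * ∑ t ∈ Finset.range T, f y (Z t ω) with havg
  have habs : ∀ y ∈ S, |h y| ≤ M := by
    intro y hy
    have := norm_integral_le_of_norm_le_const (μ := ν) (f := f y) (C := M) (hfM y hy)
    simpa using this
  set good : Set Ω := {ω | ∀ t, MonotoneOn (fun y => f y (Z t ω)) S}
  have hgood : P goodᶜ = 0 := by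
    have : ∀ᵐ ω ∂P, ∀ t, MonotoneOn (fun y => f y (Z t ω)) S := by
      rw [ae_all_iff]
      intro t
      have hm := hmono
      rw [← (hlaw t).map_eq] at hm
      exact ae_of_ae_map (hlaw t).aemeasurable hm
    exact this
  -- On slice `k` the mean lies in `[lvl k, lvl k + ε)`. An average below the mean by `2 * ε` is
  -- thus below `lvl k - ε`, which is itself at least `ε` below the mean.
  set lvl : ℕ → ℝ := fun k => -M + k * ε
  set S' : ℕ → Set ℝ := fun k => {y ∈ S | ⌊(h y + M) / ε⌋₊ = k}
  set Ev : ℕ → ℝ → Set Ω := fun k y => {ω ∈ good | avg y ω < lvl k - ε}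
  have hEv : ∀ k, AntitoneOn (Ev k) (S' k) := by
    rintro k y ⟨hy, -⟩ z ⟨hz, -⟩ hyz ω ⟨hω, hlt⟩
    refine ⟨hω, lt_of_le_of_lt ?_ hlt⟩
    exact mul_le_mul_of_nonneg_left (Finset.sum_le_sum fun t _ => hω t hy hz hyz) (by positivity)
  have hpos : ∀ y ∈ S, 0 ≤ (h y + M) / ε := fun y hy =>
    div_nonneg (by linarith [(abs_le.1 (habs y hy)).1]) hε.le
  have hEvP : ∀ k, ∀ y ∈ S' k,
      P (Ev k y) ≤ ENNReal.ofReal (Real.exp (-(T * ε ^ 2 / (2 * M ^ 2)))) := by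
    rintro k y ⟨hy, hk⟩
    refine (measure_mono ?_).trans
      (measure_average_le_sub P ν Z hindep hlaw (hf y) hM (hfM y hy) hε.le hT)
    rintro ω ⟨-, hlt⟩
    have h1 : (k : ℝ) ≤ (h y + M) / ε := by
      rw [← hk]; exact Nat.floor_le (hpos y hy)
    rw [le_div_iff₀ hε] at h1
    change avg y ω ≤ h y - ε
    simp only [lvl] at hlt
    linarith
  have hcover : {ω | ∃ y ∈ S, avg y ω < h y - 2 * ε} ⊆
      goodᶜ ∪ ⋃ k ∈ Finset.range N, ⋃ y ∈ S' k, Ev k y := by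
    rintro ω ⟨y, hy, hlt⟩
    by_cases hω : ω ∈ good
    · right
      have h2 : (h y + M) / ε ≤ 2 * M / ε := by
        have := (abs_le.1 (habs y hy)).2
        gcongr; linarith
      simp only [Set.mem_iUnion, Finset.mem_range]
      refine ⟨⌊(h y + M) / ε⌋₊, (Nat.floor_lt (hpos y hy)).2 (h2.trans_lt hN), y, ⟨hy, rfl⟩, hω, ?_⟩
      have h3 := Nat.lt_floor_add_one ((h y + M) / ε)
      rw [div_lt_iff₀ hε] at h3
      simp only [lvl]
      linarith
    · exact Or.inl hω
  calc P {ω | ∃ y ∈ S, avg y ω < h y - 2 * ε}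
      ≤ P goodᶜ + P (⋃ k ∈ Finset.range N, ⋃ y ∈ S' k, Ev k y) :=
        (measure_mono hcover).trans (measure_union_le _ _)
    _ ≤ 0 + ∑ k ∈ Finset.range N, P (⋃ y ∈ S' k, Ev k y) := by
        rw [hgood]; gcongr; exact measure_biUnion_finset_le _ _
    _ ≤ 0 + ∑ k ∈ Finset.range N, ENNReal.ofReal (Real.exp (-(T * ε ^ 2 / (2 * M ^ 2)))) := by
        gcongr with k
        exact measure_biUnion_le_of_antitoneOn P (hEv k) (hEvP k)
    _ = _ := by simp

/-- Uniform lower deviation bound for a bounded one-parameter family of functions that is monotone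
in the parameter. -/
theorem measure_exists_average_lt (P : Measure Ω) [IsProbabilityMeasure P]
    (ν : Measure E) [IsProbabilityMeasure ν] (Z : ℕ → Ω → E) (hindep : iIndepFun Z P)
    (hlaw : ∀ t, HasLaw (Z t) ν P)
    {S : Set ℝ} {f : ℝ → E → ℝ} (hf : ∀ y, Measurable (f y)) {M : ℝ} (hM : 0 < M)
    (hfM : ∀ y ∈ S, ∀ᵐ q ∂ν, |f y q| ≤ M)
    (hmono : (∀ᵐ q ∂ν, MonotoneOn (fun y => f y q) S) ∨ ∀ᵐ q ∂ν, AntitoneOn (fun y => f y q) S)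
    {ε : ℝ} (hε : 0 < ε) {T : ℕ} (hT : 0 < T) {N : ℕ} (hN : 2 * M / ε < N) :
    P {ω | ∃ y ∈ S, (1 / (T : ℝ)) * ∑ t ∈ Finset.range T, f y (Z t ω) < ∫ q, f y q ∂ν - 2 * ε}
      ≤ N * ENNReal.ofReal (Real.exp (-(T * ε ^ 2 / (2 * M ^ 2)))) := by
  rcases hmono with hmono | hanti
  · exact measure_exists_average_lt_of_monotoneOn P ν Z hindep hlaw hf hM hfM hmono hε hT hN
  -- The reflection `y ↦ -y` turns an antitone family into a monotone one.
  · refine (measure_mono ?_).trans (measure_exists_average_lt_of_monotoneOn P ν Z hindep hlaw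
      (S := -S) (f := fun y => f (-y)) (fun y => hf (-y)) hM (fun y hy => hfM _ hy) ?_ hε hT hN)
    · rintro ω ⟨y, hy, hlt⟩
      exact ⟨-y, by simpa using hy, by simpa using hlt⟩
    · filter_upwards [hanti] with q hq y hy z hz hyz
      exact hq hz hy (neg_le_neg hyz)

end Concentration

/-! ### Lower bounds on empirical thresholds. -/

section Threshold

variable {n d : ℕ}

/-- Dividing the utility bound by the allocation bounds the unit price below by `w - u / x̂`. Since
`u ≥ 0`, this is at least `w - u / z` once `x̂ ≥ z`. -/
theorem ofReal_le_empTau (A : Auction n d) (b : ℕ → Fin n → ℝ) (g : ℕ → Fin d → ℝ) (T : ℕ)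
    (i : Fin n) {w u z : ℝ} (hu : 0 ≤ u) (hz : 0 < z)
    (h : ∀ y ∈ Set.Icc (0 : ℝ) A.B, w * empAlloc A b g T i y - empPay A b g T i y ≤ u) :
    ENNReal.ofReal (w - u / z) ≤ empTau A b g T i z := by
  refine le_iInf fun y => le_iInf fun hy => le_iInf fun hzy => ?_
  have hx : 0 < empAlloc A b g T i y := hz.trans_le hzy
  rw [← ENNReal.ofReal_div_of_pos hx]
  refine ENNReal.ofReal_le_ofReal ?_
  have h1 : u / empAlloc A b g T i y ≤ u / z := by gcongr
  have h2 : w - u / empAlloc A b g T i y ≤ empPay A b g T i y / empAlloc A b g T i y := by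
    rw [sub_le_iff_le_add, ← add_div, le_div_iff₀ hx]
    linarith [h y hy]
  linarith

theorem ofReal_integral_le_lintegral_ofReal {α : Type*} [MeasurableSpace α] {μ : Measure α}
    {f : α → ℝ} (hf : Integrable f μ) :
    ENNReal.ofReal (∫ a, f a ∂μ) ≤ ∫⁻ a, ENNReal.ofReal (f a) ∂μ := by
  rw [integral_eq_lintegral_pos_part_sub_lintegral_neg_part hf]
  exact (ENNReal.ofReal_le_ofReal (sub_le_self _ ENNReal.toReal_nonneg)).trans
    ENNReal.ofReal_toReal_le

/-- A utility bound `u` for the empirical auction forces the empirical threshold to be large. -/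
theorem ofReal_le_empThreshold (A : Auction n d) (b : ℕ → Fin n → ℝ) (g : ℕ → Fin d → ℝ) (T : ℕ)
    (i : Fin n) {w u x m : ℝ} (hu : 0 ≤ u) (hx : 0 ≤ x) (hm : 0 < m)
    (h : ∀ y ∈ Set.Icc (0 : ℝ) A.B, w * empAlloc A b g T i y - empPay A b g T i y ≤ u) :
    ENNReal.ofReal ((1 - Real.exp (-m)) * (w * x) - m * u) ≤ empThreshold A b g T i x := by
  rcases hx.eq_or_lt with rfl | hx
  · rw [ENNReal.ofReal_of_nonpos]
    · exact zero_le
    · have := mul_nonneg hm.le hu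
      linarith
  -- This lower limit makes the integral of `1 / z` over `[a, x]` equal to `m` and leaves an
  -- interval of length `(1 - exp(-m)) x`.
  set a := Real.exp (-m) * x with ha
  have ha0 : 0 < a := by positivity
  have hax : a ≤ x := by
    have : Real.exp (-m) ≤ 1 := Real.exp_le_one_iff.2 (by linarith)
    nlinarith
  have hcont : ContinuousOn (fun z : ℝ => w - u / z) (Set.uIcc a x) := by
    rw [Set.uIcc_of_le hax]
    refine continuousOn_const.sub (continuousOn_const.div continuousOn_id fun z hz => ?_)
    exact (ha0.trans_le hz.1).ne'
  have hint : IntervalIntegrable (fun z : ℝ => w - u / z) volume a x := hcont.intervalIntegrable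
  have hval : ∫ z in a..x, (w - u / z) = (1 - Real.exp (-m)) * (w * x) - m * u := by
    have hinv : ∫ z in a..x, (z : ℝ)⁻¹ = m := by
      rw [integral_inv_of_pos ha0 hx, ha, div_mul_eq_div_div_swap, div_self hx.ne', one_div,
        ← Real.exp_neg, neg_neg, Real.log_exp]
    have hint' : IntervalIntegrable (fun z : ℝ => u / z) volume a x := by
      refine ContinuousOn.intervalIntegrable ?_
      rw [Set.uIcc_of_le hax]
      exact continuousOn_const.div continuousOn_id fun z hz => (ha0.trans_le hz.1).ne'
    rw [intervalIntegral.integral_sub intervalIntegrable_const hint']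
    simp only [div_eq_mul_inv, intervalIntegral.integral_const_mul, hinv,
      intervalIntegral.integral_const, smul_eq_mul]
    rw [ha]; ring
  rw [← hval, intervalIntegral.integral_of_le hax]
  refine (ofReal_integral_le_lintegral_ofReal
    ((intervalIntegrable_iff_integrableOn_Ioc_of_le hax).1 hint)).trans ?_
  calc ∫⁻ z in Set.Ioc a x, ENNReal.ofReal (w - u / z)
      ≤ ∫⁻ z in Set.Ioc a x, empTau A b g T i z := by
        refine setLIntegral_mono_ae' measurableSet_Ioc (Eventually.of_forall fun z hz => ?_)
        exact ofReal_le_empTau A b g T i hu (ha0.trans hz.1) h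
    _ ≤ empThreshold A b g T i x := lintegral_mono_set (Set.Ioc_subset_Ioc_left ha0.le)

theorem sum_le_of_empMaxThreshold_le (A : Auction n d) (G : Measure (Fin d → ℝ))
    (b : ℕ → Fin n → ℝ) (g : ℕ → Fin d → ℝ) (T : ℕ) {w u x : Fin n → ℝ} {m r : ℝ}
    (hu : ∀ i, 0 ≤ u i) (hx : ∀ i, 0 ≤ x i) (hxG : x ∈ marginallyFeasible A G) (hm : 0 < m)
    (h : ∀ i, ∀ y ∈ Set.Icc (0 : ℝ) A.B,
      w i * empAlloc A b g T i y - empPay A b g T i y ≤ u i)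
    (hr : 0 ≤ r) (hT : empMaxThreshold A G b g T ≤ ENNReal.ofReal r) :
    ∑ i, ((1 - Real.exp (-m)) * (w i * x i) - m * u i) ≤ r := by
  rw [← ENNReal.ofReal_le_ofReal_iff hr]
  refine le_trans ?_ ((le_iSup₂_of_le x hxG le_rfl).trans hT)
  calc ENNReal.ofReal (∑ i, ((1 - Real.exp (-m)) * (w i * x i) - m * u i))
      ≤ ENNReal.ofReal (∑ i, max ((1 - Real.exp (-m)) * (w i * x i) - m * u i) 0) :=
        ENNReal.ofReal_le_ofReal (Finset.sum_le_sum fun i _ => le_max_left _ _)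
    _ = ∑ i, ENNReal.ofReal ((1 - Real.exp (-m)) * (w i * x i) - m * u i) := by
        rw [ENNReal.ofReal_sum_of_nonneg fun i _ => le_max_right _ _]
        simp [ENNReal.ofReal_max]
    _ ≤ _ := Finset.sum_le_sum fun i _ => ofReal_le_empThreshold A b g T i (hu i) (hx i) hm (h i)

end Threshold

/-! ### Replacing one bidder's value by an independent copy. -/

section Resampling

variable {n d : ℕ}

/-- Resampling one coordinate of a product measure. -/
theorem measurePreserving_update (F : Fin n → Measure ℝ) [∀ i, IsProbabilityMeasure (F i)]
    (i : Fin n) :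
    MeasurePreserving (fun p : ℝ × (Fin n → ℝ) => Function.update p.2 i p.1)
      ((F i).prod (Measure.pi F)) (Measure.pi F) := by
  have hmeas : Measurable (fun p : ℝ × (Fin n → ℝ) => Function.update p.2 i p.1) := by
    refine measurable_pi_iff.2 fun j => ?_
    by_cases hj : j = i
    · subst hj; simpa using measurable_fst
    · simp only [Function.update_of_ne hj]
      fun_prop
  refine ⟨hmeas, (Measure.pi_eq fun s hs => ?_).symm⟩
  rw [Measure.map_apply hmeas (MeasurableSet.univ_pi hs)]
  have : (fun p : ℝ × (Fin n → ℝ) => Function.update p.2 i p.1) ⁻¹' Set.pi Set.univ s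
      = s i ×ˢ Set.pi Set.univ (Function.update s i Set.univ) := by
    ext ⟨w, v⟩
    simp only [Set.mem_preimage, Set.mem_pi, Set.mem_univ, true_imp_iff, Set.mem_prod]
    constructor
    · intro h
      refine ⟨by simpa using h i, fun j => ?_⟩
      by_cases hj : j = i
      · subst hj; simp
      · simpa [Function.update_of_ne hj] using h j
    · rintro ⟨h1, h2⟩ j
      by_cases hj : j = i
      · subst hj; simpa using h1
      · simpa [Function.update_of_ne hj] using h2 j
  rw [this, Measure.prod_prod, Measure.pi_pi,
    ← Finset.mul_prod_erase Finset.univ (fun j => F j (s j)) (Finset.mem_univ i),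
    ← Finset.mul_prod_erase Finset.univ _ (Finset.mem_univ i)]
  simp only [Function.update_self, measure_univ, one_mul]
  congr 1
  refine Finset.prod_congr rfl fun j hj => ?_
  rw [Function.update_of_ne (Finset.ne_of_mem_erase hj)]

theorem measurePreserving_resample (F : Fin n → Measure ℝ) [∀ i, IsProbabilityMeasure (F i)]
    (G : Measure (Fin d → ℝ)) [IsProbabilityMeasure G] (i : Fin n) :
    MeasurePreserving
      (fun p : ℝ × (Fin n → ℝ) × (Fin d → ℝ) => (Function.update p.2.1 i p.1, p.2.2))
      ((F i).prod (joint F G)) (joint F G) :=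
  ((measurePreserving_update F i).prod (MeasurePreserving.id G)).comp
    (measurePreserving_prodAssoc (F i) (Measure.pi F) G).symm

end Resampling

/-! ### Utilities, revenue and welfare in equilibrium. -/

section Environment

variable {n d : ℕ}

instance (F : Fin n → Measure ℝ) [∀ i, IsProbabilityMeasure (F i)]
    (G : Measure (Fin d → ℝ)) [IsProbabilityMeasure G] : IsProbabilityMeasure (joint F G) :=
  inferInstanceAs (IsProbabilityMeasure ((Measure.pi F).prod G))

/-- Values, contexts and measurable strategies live in the spaces prescribed by the auction. -/
structure IsEnvironment (A : Auction n d) (V : Fin n → Set ℝ) (F : Fin n → Measure ℝ)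
    (G : Measure (Fin d → ℝ)) (σ : Fin n → ℝ → ℝ) : Prop where
  value_nonneg : ∀ i, V i ⊆ Set.Ici 0
  ae_value : ∀ i, ∀ᵐ w ∂(F i), w ∈ V i
  integrable_value : ∀ i, Integrable (fun w : ℝ => w) (F i)
  ae_context : ∀ᵐ γ ∂G, γ ∈ A.Γ
  measurable_strategy : ∀ i, Measurable (σ i)
  mapsTo : ∀ i, Set.MapsTo (σ i) (V i) (Set.Icc 0 A.B)

theorem update_mem_bidProfiles {B : ℝ} {b : Fin n → ℝ} (hb : b ∈ bidProfiles n B) (i : Fin n)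
    {y : ℝ} (hy : y ∈ Set.Icc 0 B) : Function.update b i y ∈ bidProfiles n B := by
  intro j
  by_cases hj : j = i
  · subst hj; simpa using hy
  · simpa [Function.update_of_ne hj] using hb j

theorem bids_update (σ : Fin n → ℝ → ℝ) (v : Fin n → ℝ) (i : Fin n) (w : ℝ) :
    bids σ (Function.update v i w) = Function.update (bids σ v) i (σ i w) := by
  ext j
  by_cases hj : j = i
  · subst hj; simp [bids]
  · simp [bids, Function.update_of_ne hj]

theorem bids_mem {A : Auction n d} {V : Fin n → Set ℝ} {σ : Fin n → ℝ → ℝ}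
    (h : ∀ i, Set.MapsTo (σ i) (V i) (Set.Icc 0 A.B)) {v : Fin n → ℝ} (hv : ∀ i, v i ∈ V i) :
    bids σ v ∈ bidProfiles n A.B := fun i => h i (hv i)

theorem measurable_bids {σ : Fin n → ℝ → ℝ} (h : ∀ i, Measurable (σ i)) : Measurable (bids σ) :=
  measurable_pi_iff.2 fun i => (h i).comp (measurable_pi_apply i)

theorem measurable_rule {f : (Fin n → ℝ) → (Fin d → ℝ) → Fin n → ℝ}
    (hf : Measurable (Function.uncurry f)) {α : Type*} [MeasurableSpace α] {β : α → Fin n → ℝ}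
    {γ : α → Fin d → ℝ} (hβ : Measurable β) (hγ : Measurable γ) (i : Fin n) :
    Measurable fun a => f (β a) (γ a) i :=
  (measurable_pi_apply i).comp (hf.comp (hβ.prodMk hγ))

theorem BoundedMonotoneRules.exists_bound {A : Auction n d} (hA : BoundedMonotoneRules A) :
    ∃ M : ℝ, 0 < M ∧ ∀ i, ∀ b ∈ bidProfiles n A.B, ∀ γ ∈ A.Γ,
      |A.alloc b γ i| ≤ M ∧ |A.pay b γ i| ≤ M := by
  obtain ⟨xbar, pbar, h⟩ := hA.bounded
  refine ⟨1 + ∑ i, (|xbar i| + |pbar i|), by positivity, fun i b hb γ hγ => ?_⟩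
  have hi : |xbar i| + |pbar i| ≤ ∑ i, (|xbar i| + |pbar i|) :=
    Finset.single_le_sum (f := fun i => |xbar i| + |pbar i|) (fun j _ => by positivity)
      (Finset.mem_univ i)
  have hx := (h i b hb γ hγ).1.trans (le_abs_self _)
  have hp := (h i b hb γ hγ).2.trans (le_abs_self _)
  have := abs_nonneg (xbar i)
  have := abs_nonneg (pbar i)
  constructor <;> linarith

/-- Realized utility of bidder `i` under the strategies `σ`. -/
noncomputable def realizedUtil (A : Auction n d) (σ : Fin n → ℝ → ℝ) (i : Fin n)
    (q : (Fin n → ℝ) × (Fin d → ℝ)) : ℝ :=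
  q.1 i * A.alloc (bids σ q.1) q.2 i - A.pay (bids σ q.1) q.2 i

/-- Expected revenue of the strategy profile `σ`. -/
noncomputable def revenue (A : Auction n d) (F : Fin n → Measure ℝ) (G : Measure (Fin d → ℝ))
    (σ : Fin n → ℝ → ℝ) : ℝ :=
  ∫ q, ∑ i, A.pay (bids σ q.1) q.2 i ∂(joint F G)

namespace IsEnvironment

variable {A : Auction n d} {V : Fin n → Set ℝ} {F : Fin n → Measure ℝ}
  [∀ i, IsProbabilityMeasure (F i)] {G : Measure (Fin d → ℝ)}
  {σ : Fin n → ℝ → ℝ}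

theorem ae_values (h : IsEnvironment A V F G σ) : ∀ᵐ v ∂(Measure.pi F), ∀ i, v i ∈ V i := by
  rw [ae_all_iff]
  exact fun i => (measurePreserving_eval F i).quasiMeasurePreserving.ae (h.ae_value i)

theorem integrable_coord (h : IsEnvironment A V F G σ) (i : Fin n) :
    Integrable (fun v : Fin n → ℝ => v i) (Measure.pi F) :=
  (measurePreserving_eval F i).integrable_comp_of_integrable (h.integrable_value i)

theorem ae_joint [SFinite G] (h : IsEnvironment A V F G σ) :
    ∀ᵐ q ∂(joint F G), (∀ i, q.1 i ∈ V i) ∧ q.2 ∈ A.Γ :=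
  (Measure.quasiMeasurePreserving_fst.ae h.ae_values).and
    (Measure.quasiMeasurePreserving_snd.ae h.ae_context)

variable [IsProbabilityMeasure G]

theorem integrable_coord_joint (h : IsEnvironment A V F G σ) (i : Fin n) :
    Integrable (fun q : (Fin n → ℝ) × (Fin d → ℝ) => q.1 i) (joint F G) :=
  (h.integrable_coord i).comp_fst G

theorem integrable_coord_mul (h : IsEnvironment A V F G σ) (i : Fin n)
    {f : (Fin n → ℝ) × (Fin d → ℝ) → ℝ} (hf : Measurable f)
    (hb : ∀ᵐ q ∂(joint F G), f q ∈ Set.Icc (0 : ℝ) 1) :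
    Integrable (fun q => q.1 i * f q) (joint F G) :=
  (h.integrable_coord_joint i).mul_bdd hf.aestronglyMeasurable (by
    filter_upwards [hb] with q hq
    rw [Real.norm_of_nonneg hq.1]; exact hq.2)

theorem alloc_mem_Icc (h : IsEnvironment A V F G σ) (i : Fin n) :
    ∀ᵐ q ∂(joint F G), A.alloc (bids σ q.1) q.2 i ∈ Set.Icc (0 : ℝ) 1 := by
  filter_upwards [h.ae_joint] with q hq
  exact A.X_subset _ hq.2 _ (A.alloc_mem _ (bids_mem h.mapsTo hq.1) _ hq.2) i

theorem integrable_value_mul_alloc (h : IsEnvironment A V F G σ) (i : Fin n) :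
    Integrable (fun q => q.1 i * A.alloc (bids σ q.1) q.2 i) (joint F G) :=
  h.integrable_coord_mul i (measurable_rule A.measurable_alloc
    ((measurable_bids h.measurable_strategy).comp measurable_fst) measurable_snd i)
    (h.alloc_mem_Icc i)

/-- A bounded rule is integrable when bidder `i` bids `y`. -/
theorem integrable_rule_update (h : IsEnvironment A V F G σ)
    {f : (Fin n → ℝ) → (Fin d → ℝ) → Fin n → ℝ} (hf : Measurable (Function.uncurry f)) (i : Fin n)
    {M : ℝ} (hM : ∀ b ∈ bidProfiles n A.B, ∀ γ ∈ A.Γ, |f b γ i| ≤ M) {y : ℝ}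
    (hy : y ∈ Set.Icc 0 A.B) :
    Integrable (fun q => f (Function.update (bids σ q.1) i y) q.2 i) (joint F G) := by
  refine Integrable.of_bound (measurable_rule hf (Measurable.comp (measurable_update' ..)
    (((measurable_bids h.measurable_strategy).comp measurable_fst).prodMk
      measurable_const)) measurable_snd i).aestronglyMeasurable M ?_
  filter_upwards [h.ae_joint] with q hq
  exact hM _ (update_mem_bidProfiles (bids_mem h.mapsTo hq.1) i hy) _ hq.2

theorem integrable_pay (h : IsEnvironment A V F G σ) (hA : BoundedMonotoneRules A) (i : Fin n) :
    Integrable (fun q => A.pay (bids σ q.1) q.2 i) (joint F G) := by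
  obtain ⟨M, -, hM⟩ := hA.exists_bound
  refine Integrable.of_bound (measurable_rule A.measurable_pay
    ((measurable_bids h.measurable_strategy).comp measurable_fst)
      measurable_snd i).aestronglyMeasurable M ?_
  filter_upwards [h.ae_joint] with q hq
  exact (hM i _ (bids_mem h.mapsTo hq.1) _ hq.2).2

theorem integrable_realizedUtil (h : IsEnvironment A V F G σ) (hA : BoundedMonotoneRules A)
    (i : Fin n) : Integrable (realizedUtil A σ i) (joint F G) :=
  (h.integrable_value_mul_alloc i).sub (h.integrable_pay hA i)

theorem interimUtil_eq (h : IsEnvironment A V F G σ) (hA : BoundedMonotoneRules A) (i : Fin n)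
    {w : ℝ} (hw : w ∈ V i) :
    interimUtil A F G σ i (σ i w) w
      = ∫ q, realizedUtil A σ i (Function.update q.1 i w, q.2) ∂(joint F G) := by
  obtain ⟨M, -, hM⟩ := hA.exists_bound
  have hx := h.integrable_rule_update A.measurable_alloc i (fun b hb γ hγ => (hM i b hb γ hγ).1)
    (h.mapsTo i hw)
  have hp := h.integrable_rule_update A.measurable_pay i (fun b hb γ hγ => (hM i b hb γ hγ).2)
    (h.mapsTo i hw)
  simp only [realizedUtil, bids_update, Function.update_self]
  rw [integral_sub (hx.const_mul w) hp, integral_const_mul]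
  rfl

theorem integrable_resample (h : IsEnvironment A V F G σ) (hA : BoundedMonotoneRules A)
    (i : Fin n) :
    Integrable (fun p : ℝ × (Fin n → ℝ) × (Fin d → ℝ) =>
      realizedUtil A σ i (Function.update p.2.1 i p.1, p.2.2)) ((F i).prod (joint F G)) :=
  (measurePreserving_resample F G i).integrable_comp_of_integrable (h.integrable_realizedUtil hA i)

theorem integrable_interimUtil (h : IsEnvironment A V F G σ) (hA : BoundedMonotoneRules A)
    (i : Fin n) : Integrable (fun w => interimUtil A F G σ i (σ i w) w) (F i) := by
  refine (h.integrable_resample hA i).integral_prod_left.congr ?_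
  filter_upwards [h.ae_value i] with w hw
  exact (h.interimUtil_eq hA i hw).symm

/-- Redrawing the value of bidder `i` independently preserves the joint law, so Fubini separates it
from the competitors' values and the context. -/
theorem integral_interimUtil (h : IsEnvironment A V F G σ) (hA : BoundedMonotoneRules A)
    (i : Fin n) :
    ∫ w, interimUtil A F G σ i (σ i w) w ∂(F i) = ∫ q, realizedUtil A σ i q ∂(joint F G) := by
  have hres := measurePreserving_resample F G i
  rw [← hres.map_eq, integral_map hres.aemeasurable
    (by rw [hres.map_eq]; exact (h.integrable_realizedUtil hA i).aestronglyMeasurable),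
    integral_prod _ (h.integrable_resample hA i)]
  refine integral_congr_ae ?_
  filter_upwards [h.ae_value i] with w hw
  exact h.interimUtil_eq hA i hw

/-- Utilities and revenue add up to welfare. -/
theorem sum_integral_interimUtil (h : IsEnvironment A V F G σ) (hA : BoundedMonotoneRules A) :
    ∑ i, ∫ w, interimUtil A F G σ i (σ i w) w ∂(F i) = welfare A F G σ - revenue A F G σ := by
  simp only [h.integral_interimUtil hA, welfare, revenue]
  rw [integral_finsetSum _ fun i _ => h.integrable_value_mul_alloc i,
    integral_finsetSum _ fun i _ => h.integrable_pay hA i, ← Finset.sum_sub_distrib]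
  refine Finset.sum_congr rfl fun i _ => ?_
  rw [← integral_sub (h.integrable_value_mul_alloc i) (h.integrable_pay hA i)]
  rfl

theorem revenue_nonneg (h : IsEnvironment A V F G σ) : 0 ≤ revenue A F G σ := by
  refine integral_nonneg_of_ae ?_
  filter_upwards [h.ae_joint] with q hq
  exact Finset.sum_nonneg fun i _ => A.pay_nonneg _ (bids_mem h.mapsTo hq.1) _ hq.2 i

theorem welfare_nonneg (h : IsEnvironment A V F G σ) : 0 ≤ welfare A F G σ := by
  refine integral_nonneg_of_ae ?_
  filter_upwards [h.ae_joint, ae_all_iff.2 h.alloc_mem_Icc] with q hq hq'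
  exact Finset.sum_nonneg fun i _ => mul_nonneg (h.value_nonneg i (hq.1 i)) (hq' i).1

/-- Optimal welfare through the interim optimal allocations, which are marginally feasible. -/
theorem exists_interim_optimal (h : IsEnvironment A V F G σ) (hopt : HasOptimalRule A V) :
    ∃ x : (Fin n → ℝ) → Fin n → ℝ,
      (∀ᵐ v ∂(Measure.pi F), x v ∈ marginallyFeasible A G ∧ ∀ i, 0 ≤ x v i) ∧
      (∀ i, Integrable (fun v => v i * x v i) (Measure.pi F)) ∧
      optWelfare A F G = ∑ i, ∫ v, v i * x v i ∂(Measure.pi F) := by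
  obtain ⟨xopt, hmeas, hxopt⟩ := hopt
  have hIcc : ∀ i, ∀ᵐ q ∂(joint F G), xopt q.1 q.2 i ∈ Set.Icc (0 : ℝ) 1 := by
    intro i
    filter_upwards [h.ae_joint] with q hq
    exact A.X_subset _ hq.2 _ (hxopt q.1 hq.1 q.2 hq.2).1 i
  have hint : ∀ i, Integrable (fun q => q.1 i * xopt q.1 q.2 i) (joint F G) := fun i =>
    h.integrable_coord_mul i (measurable_rule hmeas measurable_fst measurable_snd i) (hIcc i)
  have hconst : ∀ i v, ∫ γ, v i * xopt v γ i ∂G = v i * ∫ γ, xopt v γ i ∂G :=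
    fun i v => integral_const_mul _ _
  -- With the values frozen, the optimal rule is a feasible policy in the context alone.
  refine ⟨fun v i => ∫ γ, xopt v γ i ∂G, ?_, fun i => ?_, ?_⟩
  · filter_upwards [h.ae_values] with v hv
    refine ⟨⟨xopt v, hmeas.comp measurable_prodMk_left, fun γ hγ => (hxopt v hv γ hγ).1,
      fun i => rfl⟩, fun i => integral_nonneg_of_ae ?_⟩
    filter_upwards [h.ae_context] with γ hγ
    exact (A.X_subset _ hγ _ (hxopt v hv γ hγ).1 i).1
  · simpa only [hconst] using (hint i).integral_prod_left
  · have : optWelfare A F G = ∫ q, ∑ i, q.1 i * xopt q.1 q.2 i ∂(joint F G) := by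
      refine integral_congr_ae ?_
      filter_upwards [h.ae_joint] with q hq
      have hq' := hxopt q.1 hq.1 q.2 hq.2
      refine IsGreatest.csSup_eq ⟨⟨_, hq'.1, rfl⟩, ?_⟩
      rintro _ ⟨x, hx, rfl⟩
      exact hq'.2 x hx
    rw [this, integral_finsetSum _ fun i _ => hint i]
    refine Finset.sum_congr rfl fun i _ => ?_
    rw [joint, integral_prod _ (hint i)]
    simp only [hconst]

/-- Welfare guarantee from an upper bound on the optimized empirical thresholds. -/
theorem le_welfare_of_empMaxThreshold_le (h : IsEnvironment A V F G σ)
    (hA : BoundedMonotoneRules A) (hopt : HasOptimalRule A V) (hσ : IsBNE A V F G σ)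
    (hIR : IndividuallyRational A V F G σ) (b : ℕ → Fin n → ℝ) (g : ℕ → Fin d → ℝ) (T : ℕ)
    {δ m r : ℝ} (hδ : 0 ≤ δ) (hm : 0 < m) (hr : 0 ≤ r)
    (hx : ∀ i, ∀ y ∈ Set.Icc (0 : ℝ) A.B, empAlloc A b g T i y ≤ interimAlloc A F G σ i y + δ)
    (hp : ∀ i, ∀ y ∈ Set.Icc (0 : ℝ) A.B, interimPay A F G σ i y ≤ empPay A b g T i y + δ)
    (hrev : r ≤ revenue A F G σ + δ)
    (hT : empMaxThreshold A G b g T ≤ ENNReal.ofReal (m * r)) :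
    (1 - Real.exp (-m)) * optWelfare A F G
      ≤ m * (welfare A F G σ + δ * (∑ i, (1 + ∫ w, w ∂(F i)) + 1)) := by
  obtain ⟨x, hxf, hxint, hOPT⟩ := h.exists_interim_optimal hopt
  -- The slack is `δ * w` for the allocation error and `δ` for the payment error.
  set U : Fin n → ℝ → ℝ := fun i w => interimUtil A F G σ i (σ i w) w + δ * (1 + w) with hU
  have hUint : ∀ i, Integrable (U i) (F i) := fun i =>
    (h.integrable_interimUtil hA i).add
      (((integrable_const 1).add (h.integrable_value i)).const_mul δ)
  have hUpi : ∀ i, Integrable (fun v : Fin n → ℝ => U i (v i)) (Measure.pi F) := fun i =>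
    (measurePreserving_eval F i).integrable_comp_of_integrable (hUint i)
  have hterm : ∀ i, Integrable (fun v => (1 - Real.exp (-m)) * (v i * x v i) - m * U i (v i))
      (Measure.pi F) := fun i => ((hxint i).const_mul _).sub ((hUpi i).const_mul m)
  have hpt : ∀ᵐ v ∂(Measure.pi F),
      ∑ i, ((1 - Real.exp (-m)) * (v i * x v i) - m * U i (v i)) ≤ m * r := by
    filter_upwards [h.ae_values, hxf] with v hv hxv
    refine sum_le_of_empMaxThreshold_le A G b g T (fun i => ?_) hxv.2 hxv.1 hm (fun i y hy => ?_)
      (by positivity) hT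
    · have h0 : (0 : ℝ) ≤ v i := h.value_nonneg i (hv i)
      exact add_nonneg (hIR i _ (hv i)) (by positivity)
    · have h0 : (0 : ℝ) ≤ v i := h.value_nonneg i (hv i)
      have h1 := hσ.best_response i _ (hv i) y hy
      have h2 := mul_le_mul_of_nonneg_left (hx i y hy) h0
      have h3 := hp i y hy
      simp only [hU]
      unfold interimUtil at h1 ⊢
      linarith
  -- The sample is fixed here, so the right-hand side of `hpt` is constant in `v`.
  have hmono := integral_mono_ae (integrable_finsetSum _ fun i _ => hterm i)
    (integrable_const (m * r)) hpt
  rw [integral_finsetSum _ fun i _ => hterm i, integral_const, probReal_univ, one_smul] at hmono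
  have hUval : ∑ i, ∫ v, U i (v i) ∂(Measure.pi F)
      = welfare A F G σ - revenue A F G σ + δ * ∑ i, (1 + ∫ w, w ∂(F i)) := by
    rw [← h.sum_integral_interimUtil hA, Finset.mul_sum, ← Finset.sum_add_distrib]
    refine Finset.sum_congr rfl fun i _ => ?_
    have hev := measurePreserving_eval F i
    have hcomp : ∫ w, U i w ∂(F i) = ∫ v, U i (v i) ∂(Measure.pi F) := by
      rw [← hev.map_eq]
      exact integral_map hev.aemeasurable
        (by rw [hev.map_eq]; exact (hUint i).aestronglyMeasurable)
    have hlin : Integrable (fun w : ℝ => 1 + w) (F i) :=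
      (integrable_const 1).add (h.integrable_value i)
    rw [← hcomp, integral_add (h.integrable_interimUtil hA i) (hlin.const_mul δ),
      integral_const_mul, integral_add (integrable_const 1) (h.integrable_value i)]
    simp
  have hsum : ∑ i, ∫ v, ((1 - Real.exp (-m)) * (v i * x v i) - m * U i (v i)) ∂(Measure.pi F)
      = (1 - Real.exp (-m)) * optWelfare A F G
        - m * (welfare A F G σ - revenue A F G σ + δ * ∑ i, (1 + ∫ w, w ∂(F i))) := by
    rw [← hUval, hOPT, Finset.mul_sum, Finset.mul_sum, ← Finset.sum_sub_distrib]
    refine Finset.sum_congr rfl fun i _ => ?_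
    rw [integral_sub ((hxint i).const_mul _) ((hUpi i).const_mul m), integral_const_mul,
      integral_const_mul]
  have := mul_le_mul_of_nonneg_left hrev hm.le
  rw [hsum] at hmono
  linarith

end IsEnvironment

end Environment

/-! ### From the deterministic guarantee to high probability. -/

section Estimation

variable {n d : ℕ} {A : Auction n d} {V : Fin n → Set ℝ} {F : Fin n → Measure ℝ}
  {G : Measure (Fin d → ℝ)} {σ : Fin n → ℝ → ℝ}

theorem IsEnvironment.integral_value_nonneg (h : IsEnvironment A V F G σ) (i : Fin n) :
    0 ≤ ∫ w, w ∂(F i) := by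
  refine integral_nonneg_of_ae ?_
  filter_upwards [h.ae_value i] with w hw using h.value_nonneg i hw

variable [∀ i, IsProbabilityMeasure (F i)] [IsProbabilityMeasure G]

/-- Welfare guarantee with the estimated parameter, when the empirical interim outcomes and the
empirical revenue are within `δ` of the true ones. -/
theorem IsEnvironment.inv_rho_muHat_mul_le (h : IsEnvironment A V F G σ)
    (hA : BoundedMonotoneRules A) (hopt : HasOptimalRule A V) (hσ : IsBNE A V F G σ)
    (hIR : IndividuallyRational A V F G σ) (b : ℕ → Fin n → ℝ) (g : ℕ → Fin d → ℝ) (T : ℕ)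
    {δ : ℝ} (hδ : 0 ≤ δ)
    (hx : ∀ i, ∀ y ∈ Set.Icc (0 : ℝ) A.B, empAlloc A b g T i y ≤ interimAlloc A F G σ i y + δ)
    (hp : ∀ i, ∀ y ∈ Set.Icc (0 : ℝ) A.B, interimPay A F G σ i y ≤ empPay A b g T i y + δ)
    (hrev : empRev A b g T ≤ revenue A F G σ + δ) :
    ((rho (muHat A G b g T))⁻¹).toReal * optWelfare A F G
      ≤ welfare A F G σ + δ * (∑ i, (1 + ∫ w, w ∂(F i)) + 1) := by
  set W := welfare A F G σ + δ * (∑ i, (1 + ∫ w, w ∂(F i)) + 1) with hW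
  have hW0 : 0 ≤ W := by
    have h1 : 0 ≤ ∑ i, (1 + ∫ w, w ∂(F i)) := Finset.sum_nonneg fun i _ => by
      linarith [h.integral_value_nonneg i]
    have := h.welfare_nonneg
    positivity
  -- The sample is arbitrary here, so payments may be negative off the domain of the rules.
  -- `ENNReal.ofReal` truncates the revenue in the same way.
  set r := max (empRev A b g T) 0
  have hr0 : 0 ≤ r := le_max_right _ _
  have hr : r ≤ revenue A F G σ + δ := max_le hrev (add_nonneg h.revenue_nonneg hδ)
  have hofr : ENNReal.ofReal (empRev A b g T) = ENNReal.ofReal r := by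
    simp [r, ENNReal.ofReal_max]
  have core : ∀ m, 0 < m → empMaxThreshold A G b g T ≤ ENNReal.ofReal (m * r) →
      (1 - Real.exp (-m)) * optWelfare A F G ≤ m * W := fun m hm hT =>
    h.le_welfare_of_empMaxThreshold_le hA hopt hσ hIR b g T hδ hm hr0 hx hp hr hT
  by_cases htop : muHat A G b g T = ∞
  · simpa [rho, htop] using hW0
  by_cases hzero : muHat A G b g T = 0
  · have hT0 : empMaxThreshold A G b g T = 0 := by
      rcases ENNReal.div_eq_zero_iff.1 hzero with h0 | h0
      · exact h0
      · exact absurd h0 ENNReal.ofReal_ne_top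
    simp only [rho, hzero, if_true, inv_one, ENNReal.toReal_one, one_mul]
    rcases le_total (optWelfare A F G) 0 with hneg | hpos
    · exact hneg.trans hW0
    -- Here `core` applies to every `m > 0`, and the claim is its limit as `m → 0`, where `(1 -
    -- exp(-m)) / m` tends to `1`.
    refine le_of_forall_pos_le_add fun ε hε => ?_
    set m := ε / (W + 1) with hm
    have hm0 : 0 < m := by positivity
    have h1 := core m hm0 (by rw [hT0]; exact zero_le)
    have h2 : m / (1 + m) ≤ 1 - Real.exp (-m) := by
      have h3 : Real.exp (-m) ≤ (1 + m)⁻¹ := by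
        rw [Real.exp_neg]
        exact inv_anti₀ (by positivity) (by linarith [Real.add_one_le_exp m])
      have h4 : m / (1 + m) = 1 - (1 + m)⁻¹ := by field_simp; ring
      linarith
    have h5 := (mul_le_mul_of_nonneg_right h2 hpos).trans h1
    have h6 : optWelfare A F G ≤ (1 + m) * W := by
      rw [div_mul_eq_mul_div, div_le_iff₀ (by positivity)] at h5
      nlinarith
    have h7 : m * W ≤ ε := by
      rw [hm, div_mul_eq_mul_div, div_le_iff₀ (by positivity)]
      nlinarith
    linarith
  · set m := (muHat A G b g T).toReal with hm
    have hm0 : 0 < m := ENNReal.toReal_pos hzero htop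
    have hr_ne : ENNReal.ofReal (empRev A b g T) ≠ 0 := by
      intro h0
      by_cases hT0 : empMaxThreshold A G b g T = 0
      · exact hzero (by rw [muHat, hT0, ENNReal.zero_div])
      · exact htop (by rw [muHat, h0, ENNReal.div_zero hT0])
    have hT : empMaxThreshold A G b g T = ENNReal.ofReal (m * r) := by
      rw [ENNReal.ofReal_mul hm0.le, hm, ENNReal.ofReal_toReal htop, ← hofr, muHat,
        ENNReal.div_mul_cancel hr_ne ENNReal.ofReal_ne_top]
    have h1 := core m hm0 hT.le
    have h2 : 0 < 1 - Real.exp (-m) := by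
      have : Real.exp (-m) < 1 := by simpa using hm0
      linarith
    have h3 : ((rho (muHat A G b g T))⁻¹).toReal = (1 - Real.exp (-m)) / m := by
      rw [rho, if_neg hzero, if_neg htop, ← hm, ENNReal.toReal_inv,
        ENNReal.toReal_ofReal (by positivity), mul_inv, inv_inv, inv_mul_eq_div]
    rw [h3, div_mul_eq_mul_div, div_le_iff₀ hm0]
    linarith

theorem MonotoneInOwnBid.ae {f : (Fin n → ℝ) → (Fin d → ℝ) → Fin n → ℝ} {i : Fin n}
    (hf : MonotoneInOwnBid A f i) (h : IsEnvironment A V F G σ) :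
    (∀ᵐ q ∂(joint F G),
      MonotoneOn (fun y => f (Function.update (bids σ q.1) i y) q.2 i) (Set.Icc 0 A.B)) ∨
    (∀ᵐ q ∂(joint F G),
      AntitoneOn (fun y => f (Function.update (bids σ q.1) i y) q.2 i) (Set.Icc 0 A.B)) := by
  refine hf.imp (fun hf => ?_) fun hf => ?_ <;>
  · filter_upwards [h.ae_joint] with q hq
    exact hf _ (bids_mem h.mapsTo hq.1) _ hq.2

theorem BoundedMonotoneRules.exists_bound_revenue (hA : BoundedMonotoneRules A) :
    ∃ M : ℝ, 0 < M ∧ ∀ b ∈ bidProfiles n A.B, ∀ γ ∈ A.Γ,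
      (∀ i, |A.alloc b γ i| ≤ M) ∧ (∀ i, |A.pay b γ i| ≤ M) ∧ |∑ i, A.pay b γ i| ≤ M := by
  obtain ⟨M, hM, h⟩ := hA.exists_bound
  have hMn : 0 ≤ n * M := by positivity
  refine ⟨M + n * M, by positivity, fun b hb γ hγ => ⟨fun i => ?_, fun i => ?_, ?_⟩⟩
  · linarith [(h i b hb γ hγ).1]
  · linarith [(h i b hb γ hγ).2]
  · refine (Finset.abs_sum_le_sum_abs _ _).trans
      ((Finset.sum_le_sum fun i _ => (h i b hb γ hγ).2).trans ?_)
    simp [hM.le]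

/-- With high probability the empirical interim outcomes are uniformly close to the true ones, and
so is the empirical revenue. -/
theorem IsEnvironment.measure_deviation_le (h : IsEnvironment A V F G σ)
    (hA : BoundedMonotoneRules A) {Ω : Type*} [MeasurableSpace Ω] (P : Measure Ω)
    [IsProbabilityMeasure P] (v : ℕ → Ω → Fin n → ℝ) (g : ℕ → Ω → Fin d → ℝ)
    (hindep : iIndepFun (fun t ω => (v t ω, g t ω)) P)
    (hlaw : ∀ t, HasLaw (fun ω => (v t ω, g t ω)) (joint F G) P) {M : ℝ} (hM0 : 0 < M)
    (hM : ∀ b ∈ bidProfiles n A.B, ∀ γ ∈ A.Γ,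
      (∀ i, |A.alloc b γ i| ≤ M) ∧ (∀ i, |A.pay b γ i| ≤ M) ∧ |∑ i, A.pay b γ i| ≤ M)
    {ε : ℝ} (hε : 0 < ε) {T : ℕ} (hT : 0 < T) :
    P {ω | ¬ ((∀ i, ∀ y ∈ Set.Icc (0 : ℝ) A.B,
          empAlloc A (fun t => bids σ (v t ω)) (fun t => g t ω) T i y
            ≤ interimAlloc A F G σ i y + 2 * ε) ∧
        (∀ i, ∀ y ∈ Set.Icc (0 : ℝ) A.B, interimPay A F G σ i y
          ≤ empPay A (fun t => bids σ (v t ω)) (fun t => g t ω) T i y + 2 * ε) ∧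
        empRev A (fun t => bids σ (v t ω)) (fun t => g t ω) T ≤ revenue A F G σ + 2 * ε)}
      ≤ ENNReal.ofReal ((2 * n + 1) * (2 * M / ε + 1)
          * Real.exp (-(T * ε ^ 2 / (2 * M ^ 2)))) := by
  set e := Real.exp (-(T * ε ^ 2 / (2 * M ^ 2))) with he
  set N := ⌊2 * M / ε⌋₊ + 1 with hNdef
  have hN : 2 * M / ε < N := by rw [hNdef]; push_cast; exact Nat.lt_floor_add_one _
  have hbids := measurable_bids h.measurable_strategy
  have hupd : ∀ i y, Measurable fun q : (Fin n → ℝ) × (Fin d → ℝ) =>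
      Function.update (bids σ q.1) i y := fun i y => Measurable.comp (measurable_update' ..)
    ((hbids.comp measurable_fst).prodMk measurable_const)
  set X : Fin n → ℝ → (Fin n → ℝ) × (Fin d → ℝ) → ℝ :=
    fun i y q => A.alloc (Function.update (bids σ q.1) i y) q.2 i
  set Y : Fin n → ℝ → (Fin n → ℝ) × (Fin d → ℝ) → ℝ :=
    fun i y q => A.pay (Function.update (bids σ q.1) i y) q.2 i
  set R : (Fin n → ℝ) × (Fin d → ℝ) → ℝ := fun q => ∑ i, A.pay (bids σ q.1) q.2 i
  have hX : ∀ i y, Measurable (X i y) := fun i y =>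
    measurable_rule A.measurable_alloc (hupd i y) measurable_snd i
  have hY : ∀ i y, Measurable (Y i y) := fun i y =>
    measurable_rule A.measurable_pay (hupd i y) measurable_snd i
  have hR : Measurable R := Finset.measurable_sum _ fun i _ =>
    measurable_rule A.measurable_pay (hbids.comp measurable_fst) measurable_snd i
  -- Allocations and revenue need upper deviation bounds, so they enter the lower-tail lemmas
  -- negated.
  have hbX : ∀ i, P {ω | ∃ y ∈ Set.Icc (0 : ℝ) A.B,
      (1 / (T : ℝ)) * ∑ t ∈ Finset.range T, -X i y (v t ω, g t ω)
        < ∫ q, -X i y q ∂(joint F G) - 2 * ε} ≤ N * ENNReal.ofReal e := by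
    intro i
    refine measure_exists_average_lt P (joint F G) _ hindep hlaw (fun y => (hX i y).neg) hM0
      (fun y hy => ?_) ?_ hε hT hN
    · filter_upwards [h.ae_joint] with q hq
      rw [Pi.neg_apply, abs_neg]
      exact (hM _ (update_mem_bidProfiles (bids_mem h.mapsTo hq.1) i hy) _ hq.2).1 i
    · rcases (hA.alloc_own i).ae h with hm | hm
      · exact Or.inr (hm.mono fun q hq => hq.neg)
      · exact Or.inl (hm.mono fun q hq => hq.neg)
  have hbY : ∀ i, P {ω | ∃ y ∈ Set.Icc (0 : ℝ) A.B,
      (1 / (T : ℝ)) * ∑ t ∈ Finset.range T, Y i y (v t ω, g t ω)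
        < ∫ q, Y i y q ∂(joint F G) - 2 * ε} ≤ N * ENNReal.ofReal e := by
    intro i
    refine measure_exists_average_lt P (joint F G) _ hindep hlaw (hY i) hM0
      (fun y hy => ?_) ((hA.pay_own i).ae h) hε hT hN
    filter_upwards [h.ae_joint] with q hq
    exact (hM _ (update_mem_bidProfiles (bids_mem h.mapsTo hq.1) i hy) _ hq.2).2.1 i
  have hbR : P {ω | (1 / (T : ℝ)) * ∑ t ∈ Finset.range T, -R (v t ω, g t ω)
        ≤ ∫ q, -R q ∂(joint F G) - ε} ≤ ENNReal.ofReal e := by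
    refine measure_average_le_sub P (joint F G) _ hindep hlaw hR.neg hM0 ?_ hε.le hT
    filter_upwards [h.ae_joint] with q hq
    rw [Pi.neg_apply, abs_neg]
    exact (hM _ (bids_mem h.mapsTo hq.1) _ hq.2).2.2
  set EX := fun i => {ω | ∃ y ∈ Set.Icc (0 : ℝ) A.B,
      (1 / (T : ℝ)) * ∑ t ∈ Finset.range T, -X i y (v t ω, g t ω)
        < ∫ q, -X i y q ∂(joint F G) - 2 * ε}
  set EY := fun i => {ω | ∃ y ∈ Set.Icc (0 : ℝ) A.B,
      (1 / (T : ℝ)) * ∑ t ∈ Finset.range T, Y i y (v t ω, g t ω)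
        < ∫ q, Y i y q ∂(joint F G) - 2 * ε}
  set ER := {ω | (1 / (T : ℝ)) * ∑ t ∈ Finset.range T, -R (v t ω, g t ω)
        ≤ ∫ q, -R q ∂(joint F G) - ε}
  calc P _ ≤ P (((⋃ i, EX i) ∪ ⋃ i, EY i) ∪ ER) := by
        refine measure_mono fun ω hω => ?_
        by_contra hcon
        simp only [Set.mem_union, Set.mem_iUnion, not_or, not_exists] at hcon
        obtain ⟨⟨h1, h2⟩, h3⟩ := hcon
        refine hω ⟨fun i y hy => ?_, fun i y hy => ?_, ?_⟩
        · have := not_lt.1 fun hlt => h1 i ⟨y, hy, hlt⟩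
          rw [integral_neg, Finset.sum_neg_distrib] at this
          change (1 / (T : ℝ)) * ∑ t ∈ Finset.range T, X i y (v t ω, g t ω)
            ≤ ∫ q, X i y q ∂(joint F G) + 2 * ε
          linarith
        · have := not_lt.1 fun hlt => h2 i ⟨y, hy, hlt⟩
          change ∫ q, Y i y q ∂(joint F G)
            ≤ (1 / (T : ℝ)) * ∑ t ∈ Finset.range T, Y i y (v t ω, g t ω) + 2 * ε
          linarith
        · have : ∫ q, -R q ∂(joint F G) - ε
              < (1 / (T : ℝ)) * ∑ t ∈ Finset.range T, -R (v t ω, g t ω) := not_le.1 h3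
          rw [integral_neg, Finset.sum_neg_distrib] at this
          change (1 / (T : ℝ)) * ∑ t ∈ Finset.range T, R (v t ω, g t ω)
            ≤ ∫ q, R q ∂(joint F G) + 2 * ε
          linarith
    _ ≤ (∑ i, P (EX i) + ∑ i, P (EY i)) + P ER := by
        refine (measure_union_le _ _).trans (add_le_add_left ((measure_union_le _ _).trans ?_) _)
        exact add_le_add (measure_iUnion_fintype_le _ _) (measure_iUnion_fintype_le _ _)
    _ ≤ (∑ _i : Fin n, N * ENNReal.ofReal e + ∑ _i : Fin n, N * ENNReal.ofReal e)
          + ENNReal.ofReal e := by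
        gcongr with i _ i _
        exacts [hbX i, hbY i]
    _ = ENNReal.ofReal ((2 * n * N + 1) * e) := by
        rw [ENNReal.ofReal_mul (by positivity), ENNReal.ofReal_add (by positivity) zero_le_one,
          ENNReal.ofReal_mul (by positivity), ENNReal.ofReal_mul (by positivity)]
        simp
        ring
    _ ≤ _ := by
        refine ENNReal.ofReal_le_ofReal (mul_le_mul_of_nonneg_right ?_ (Real.exp_pos _).le)
        have hdiv : 0 ≤ 2 * M / ε := by positivity
        have hNle : (N : ℝ) ≤ 2 * M / ε + 1 := by
          rw [hNdef]; push_cast; linarith [Nat.floor_le hdiv]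
        have hn : (0 : ℝ) ≤ 2 * n := by positivity
        nlinarith [mul_le_mul_of_nonneg_left hNle hn]

end Estimation

/-! ### Asymptotics in the sample size, and assembly. -/

/-- The rate condition absorbs polynomial factors into the exponential tail. -/
theorem eventually_div_mul_exp_le {n d : ℕ} {a D : ℝ} (ha : 0 < a) {γ : ℕ → ℝ}
    (hpos : ∀ T, 0 < γ T) (hlim : Tendsto γ atTop (𝓝 0))
    (hrate : Tendsto (fun T : ℕ => γ T ^ (n + d) * Real.sqrt ((T : ℝ) / ((n : ℝ) ^ 2 * Real.log T)))
      atTop atTop) :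
    ∀ᶠ T : ℕ in atTop, 0 < T ∧ γ T ≤ 1 ∧
      D / γ T * Real.exp (-(a * T * γ T ^ 2)) ≤ Real.exp (-(a / 2 * T * γ T ^ 4)) := by
  -- For `n = 0` division by zero makes the rate sequence identically `0`.
  have hn : n ≠ 0 := by
    rintro rfl
    refine not_tendsto_const_atTop (0 : ℝ) (atTop : Filter ℕ) ?_
    simpa using hrate
  set K := 1 + 2 / a with hK
  have ha2 : 0 < 2 / a := by positivity
  filter_upwards [hrate.eventually_ge_atTop K, hlim.eventually_le_const one_pos,
    eventually_ge_atTop 3, eventually_ge_atTop ⌈D ^ 2⌉₊] with T hKT hs1 hT3 hTD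
  have hs := hpos T
  set s := γ T
  have hT3' : (3 : ℝ) ≤ T := by exact_mod_cast hT3
  have hT0 : (0 : ℝ) < T := by linarith
  have hDT : D ^ 2 ≤ T := Nat.ceil_le.1 hTD
  have hlog : 1 ≤ Real.log T := by
    rw [Real.le_log_iff_exp_le hT0]
    linarith [Real.exp_one_lt_d9]
  have hn1 : (1 : ℝ) ≤ (n : ℝ) ^ 2 := by
    have : (1 : ℝ) ≤ n := by exact_mod_cast Nat.one_le_iff_ne_zero.2 hn
    exact one_le_pow₀ this
  have h1 : K ≤ s * Real.sqrt (T / Real.log T) := by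
    refine hKT.trans (mul_le_mul ?_ (Real.sqrt_le_sqrt ?_) (Real.sqrt_nonneg _) hs.le)
    · exact pow_le_of_le_one hs.le hs1 (by omega)
    · gcongr
      nlinarith
  have h2 : K ^ 2 * Real.log T ≤ s ^ 2 * T := by
    have := pow_le_pow_left₀ (by positivity) h1 2
    rw [mul_pow, Real.sq_sqrt (by positivity), ← mul_div_assoc, le_div_iff₀ (by positivity)] at this
    exact this
  have hK2 : 1 ≤ K ^ 2 ∧ 2 / a ≤ K ^ 2 := by constructor <;> nlinarith
  have h3 : 1 ≤ s ^ 2 * T := by nlinarith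
  have h4 : Real.log T ≤ a / 2 * (s ^ 2 * T) := by
    have : 2 / a * Real.log T ≤ s ^ 2 * T :=
      (mul_le_mul_of_nonneg_right hK2.2 (by linarith)).trans h2
    calc Real.log T = a / 2 * (2 / a * Real.log T) := by field_simp
      _ ≤ _ := by gcongr
  -- From `s ^ 2 * T ≥ 1` and `D ^ 2 ≤ T`. The factor `T` is then paid for by half of the exponent
  -- through `h4`.
  have h5 : D / s ≤ T := by
    rw [div_le_iff₀ hs]
    refine abs_le_of_sq_le_sq' ?_ (by positivity) |>.2
    calc D ^ 2 ≤ T * 1 := by linarith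
      _ ≤ T * (s ^ 2 * T) := by gcongr
      _ = _ := by ring
  refine ⟨by omega, hs1, ?_⟩
  have h6 : s ^ 4 ≤ s ^ 2 := pow_le_pow_of_le_one hs.le hs1 (by norm_num)
  calc D / s * Real.exp (-(a * T * s ^ 2))
      ≤ Real.exp (a / 2 * (s ^ 2 * T)) * Real.exp (-(a * T * s ^ 2)) := by
        gcongr
        refine h5.trans ?_
        rw [← Real.log_le_iff_le_exp hT0]
        exact h4
    _ = Real.exp (-(a / 2 * T * s ^ 2)) := by rw [← Real.exp_add]; ring_nf
    _ ≤ _ := by gcongr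

end EmpiricalPoA

open EmpiricalPoA in
theorem mainTheorem7 {n d : ℕ} (A : EmpiricalPoA.Auction n d)
    (hA1 : EmpiricalPoA.BoundedMonotoneRules A)
    (hA2 : EmpiricalPoA.PricePerUnitBound A)
    -- value spaces, value distributions, context distribution
    (V : Fin n → Set ℝ) (hV : ∀ i, V i ⊆ Set.Ici 0)
    (F : Fin n → Measure ℝ) [∀ i, IsProbabilityMeasure (F i)]
    (hFV : ∀ i, ∀ᵐ w ∂(F i), w ∈ V i) (hFint : ∀ i, Integrable (fun w : ℝ => w) (F i))
    (G : Measure (Fin d → ℝ)) [IsProbabilityMeasure G] (hG : ∀ᵐ γ ∂G, γ ∈ A.Γ)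
    (hopt : EmpiricalPoA.HasOptimalRule A V)
    -- the equilibrium
    (σ : Fin n → ℝ → ℝ) (hσ : EmpiricalPoA.IsBNE A V F G σ)
    (hIR : EmpiricalPoA.IndividuallyRational A V F G σ)
    -- the i.i.d. sample of value profiles and contexts; the observed bids are `bids σ (v t ω)`
    {Ω : Type*} [MeasurableSpace Ω] (P : Measure Ω) [IsProbabilityMeasure P]
    (v : ℕ → Ω → Fin n → ℝ) (g : ℕ → Ω → Fin d → ℝ)
    (hindep : iIndepFun (fun t ω => (v t ω, g t ω)) P)
    (hlaw : ∀ t, HasLaw (fun ω => (v t ω, g t ω)) (EmpiricalPoA.joint F G) P) :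
    ∃ c : ℝ, 0 < c ∧ ∀ γ : ℕ → ℝ, (∀ T, 0 < γ T) → Tendsto γ atTop (𝓝 0) →
      Tendsto (fun T : ℕ => γ T ^ (n + d) * Real.sqrt ((T : ℝ) / ((n : ℝ) ^ 2 * Real.log T)))
        atTop atTop →
      ∀ᶠ T : ℕ in atTop,
        -- the failure event has outer measure at most `exp (-c T γ(T)^4)`
        P {ω | ¬ (EmpiricalPoA.welfare A F G σ ≥
            ((EmpiricalPoA.rho (EmpiricalPoA.muHat A G
                (fun t => EmpiricalPoA.bids σ (v t ω)) (fun t => g t ω) T))⁻¹).toReal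
              * EmpiricalPoA.optWelfare A F G - γ T)}
          ≤ ENNReal.ofReal (Real.exp (-(c * T * γ T ^ 4))) := by
  have henv : IsEnvironment A V F G σ := ⟨hV, hFV, hFint, hG, hσ.measurable, hσ.mapsTo⟩
  obtain ⟨M, hM0, hM⟩ := hA1.exists_bound_revenue
  set L := ∑ i, (1 + ∫ w, w ∂(F i)) + 1 with hL
  have hL0 : 0 < L := by
    have : 0 ≤ ∑ i, (1 + ∫ w, w ∂(F i)) := Finset.sum_nonneg fun i _ => by
      linarith [henv.integral_value_nonneg i]
    linarith
  set a := 1 / (8 * L ^ 2 * M ^ 2) with ha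
  have ha0 : 0 < a := by positivity
  refine ⟨a / 2, by positivity, fun γ hpos hlim hrate => ?_⟩
  -- With `ε = γ T / (2 * L)` the prefactor `2 * M / ε + 1` is at most `(4 * M * L + 1) / γ T`, as
  -- `γ T ≤ 1`. The deviation `δ = 2 * ε` then loses exactly `δ * L = γ T` in welfare.
  filter_upwards [eventually_div_mul_exp_le (D := (2 * n + 1) * (4 * M * L + 1)) ha0
    hpos hlim hrate] with T ⟨hT, hγ1, htail⟩
  have hγ := hpos T
  set ε := γ T / (2 * L) with hε
  have hε0 : 0 < ε := by positivity
  refine (measure_mono fun ω hω => mt (fun hgood => ?_) hω).trans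
    ((henv.measure_deviation_le hA1 P v g hindep hlaw hM0 hM hε0 hT).trans
      (ENNReal.ofReal_le_ofReal (le_trans ?_ htail)))
  · have := henv.inv_rho_muHat_mul_le hA1 hopt hσ hIR _ _ T (by positivity) hgood.1 hgood.2.1
      hgood.2.2
    have hεL : 2 * ε * L = γ T := by rw [hε]; field_simp
    rw [← hL, hεL] at this
    linarith
  · have h1 : T * ε ^ 2 / (2 * M ^ 2) = a * T * γ T ^ 2 := by rw [hε, ha]; field_simp; norm_num
    rw [h1]
    refine mul_le_mul_of_nonneg_right ?_ (Real.exp_pos _).le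
    rw [mul_div_assoc (2 * (n : ℝ) + 1)]
    refine mul_le_mul_of_nonneg_left ?_ (by positivity)
    rw [le_div_iff₀ hγ, add_mul, one_mul, hε]
    have : 2 * M / (γ T / (2 * L)) * γ T = 4 * M * L := by field_simp; norm_num
    linarith
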